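/- Let $\mathcal M=(\mathcal S,\mathcal A,P,r,\gamma,\rho)$ be a finite Markov decision process: $\mathcal S$ finite, $\mathcal A$ finite and non-empty, transition probabilities $P_{s,a}\in\Delta^{|\mathcal S|}$ (the probability distributions on $\mathcal S$), rewards $r:\mathcal S\times\mathcal A\to[0,1]$, discount factor $\gamma\in[0,1)$, initial distribution $\rho$. For all $s,a$ let $\sigma(P_{s,a},\cdot):\mathbb R^{|\mathcal S|}\to\mathbb R$ be a convex risk measure, i.e. $\sigma(P_{s,a},V)\le\sigma(P_{s,a},V')$ whenever $V'\le V$; $\sigma(P_{s,a},V+m)=\sigma(P_{s,a},V)-m$ for $m\in\mathbb R$; and $\sigma(P_{s,a},\cdot)$ is convex. Let the penalty $D$, with values in $(-\infty,+\infty]$, satisfy, for all $s,a$ and all $\widehat P\in\Delta^{|\mathcal S|}$, $$D(\widehat P,P_{s,a})=\sup_{V\in\mathbb R^{|\mathcal S|}}\bigl(-\sigma(P_{s,a},V)-\mathbb E_{s'\sim\widehat P}V(s')\bigr).$$ Let $\pi:\mathcal S\to\Delta^{|\mathcal A|}$ be a stationary stochastic policy. *Regularized robust MDP.* For a policy $\pi'$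 (randomized, possibly dependent on time and history) and time-dependent transition probabilities $\widehat P=\{\widehat P_{t;s,a}\}_{t\ge0}$, consider the trajectory with $a_t\sim\pi'(\cdot\mid s_0,a_0,\dots,s_{t-1},a_{t-1},s_t)$, $s_{t+1}\sim\widehat P_{t;s_t,a_t}$, and put $$J(\pi',\widehat P;s)=\mathbb E\Bigl[\sum_{t=0}^{\infty}\gamma^t\bigl(r(s_t,a_t)+\gamma D(\widehat P_{t;s_t,a_t},P_{s_t,a_t})\bigr)\Big|\,s_0=s\Bigr]$$ (with the convention $0\cdot\infty=0$), and let $J(\pi',\widehat P;s,a)$ be the same expectation given $s_0=s$, $a_0=a$. Define $\overline V^\star(s)=\sup_{\pi'}\inf_{\widehat P}J(\pi',\widehat P;s)$, $\overline V^\pi(s)=\inf_{\widehat P}J(\pi,\widehat P;s)$, $\overline Q^\star(s,a)=\sup_{\pi'}\inf_{\widehat P}J(\pi',\widehat P;s,a)$, $\overline Q^\pi(s,a)=\inf_{\widehat P}J(\pi,\widehat P;s,a)$. *Risk-sensitive MDP.* $\widetilde V^\pi$ and $\widetilde V^\star$ are the solutions in $\mathbb R^{|\mathcal S|}$ of $$\widetilde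 V^\pi(s)=\sum_a\pi(a|s)\bigl(r(s,a)-\gamma\sigma(P_{s,a},\widetilde V^\pi)\bigr),\qquad \widetilde V^\star(s)=\max_a\bigl(r(s,a)-\gamma\sigma(P_{s,a},\widetilde V^\star)\bigr),\qquad s\in\mathcal S,$$ and $\widetilde Q^\pi(s,a)=r(s,a)-\gamma\sigma(P_{s,a},\widetilde V^\pi)$, $\widetilde Q^\star(s,a)=r(s,a)-\gamma\sigma(P_{s,a},\widetilde V^\star)$. **Theorem.** The two fixed-point equations have exactly one solution each, and $\widetilde V^\star(s)=\max_{\pi'}\widetilde V^{\pi'}(s)$ for every $s$, the maximum being over stationary policies. Moreover $$\overline V^\star=\widetilde V^\star=:V^\star,\qquad \overline V^\pi=\widetilde V^\pi=:V^\pi,\qquad \overline Q^\star=\widetilde Q^\star,\qquad \overline Q^\pi=\widetilde Q^\pi .$$ The sets $\arg\max_a\bigl(r(s,a)-\gamma\sigma(P_{s,a},V^\star)\bigr)$ and $\arg\min_{\widehat P\in\Delta^{|\mathcal S|}}\bigl(D(\widehat P,P_{s,a})+\mathbb E_{s'\sim\widehat P}V(s')\bigr)$, for $V=V^\star$ and $V=V^\pi$,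 are non-empty for all $s,a$. For any choice $$\pi^\star(s)\in\arg\max_a\bigl(r(s,a)-\gamma\sigma(P_{s,a},V^\star)\bigr),\qquad \widehat P^\star_{s,a}\in\arg\min_{\widehat P}\bigl(D(\widehat P,P_{s,a})+\mathbb E_{s'\sim\widehat P}V^\star(s')\bigr),$$ the stationary deterministic policy $a_t=\pi^\star(s_t)$ and the stationary transition probabilities $\widehat P_{t;s,a}=\widehat P^\star_{s,a}$ solve the sup-inf problem from every initial state $s_0$: $\inf_{\widehat P}J(\pi^\star,\widehat P;s_0)=\overline V^\star(s_0)$ and $J(\pi^\star,\widehat P^\star;s_0)=\inf_{\widehat P}J(\pi^\star,\widehat P;s_0)$. Likewise, for any choice $\widehat P^\pi_{s,a}\in\arg\min_{\widehat P}\bigl(D(\widehat P,P_{s,a})+\mathbb E_{s'\sim\widehat P}V^\pi(s')\bigr)$, the stationary transition probabilities $\widehat P_{t;s,a}=\widehat P^\pi_{s,a}$ attain the infimum defining $\overline V^\pi(s_0)$ for every $s_0$. -/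

import Mathlib

open MeasureTheory ProbabilityTheory

noncomputable section

namespace RMDP

/-! ### Finite probability distributions -/

/-- `Δ^{|S|}`: probability distributions on a finite set. -/
abbrev Simplex (S : Type*) [Fintype S] : Type _ := stdSimplex ℝ S

section Distributions

variable {S A : Type*} [Fintype S] [Fintype A]

/-- Expectation of a real function under a finite distribution. -/
def expect (p : Simplex S) (V : S → ℝ) : ℝ := ∑ s, p.1 s * V s

/-- The point mass at `a`. -/
def point (a : A) : Simplex A :=
  letI := Classical.decEq A
  ⟨Pi.single a 1, single_mem_stdSimplex ℝ a⟩

/-- Joint law of `(s, a)` where `s ∼ p` and `a ∼ q s`. -/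
def joint (p : Simplex S) (q : S → Simplex A) : Simplex (S × A) :=
  ⟨fun x => p.1 x.1 * (q x.1).1 x.2,
    fun x => mul_nonneg (p.2.1 x.1) ((q x.1).2.1 x.2), by
      rw [Fintype.sum_prod_type]
      simp only [← Finset.mul_sum]
      simp only [(q _).2.2, mul_one, p.2.2]⟩

/-- A finite distribution as a measure. -/
def toMeasure [MeasurableSpace S] (p : Simplex S) : Measure S :=
  ∑ s, ENNReal.ofReal (p.1 s) • Measure.dirac s

instance [MeasurableSpace S] (p : Simplex S) : IsProbabilityMeasure (toMeasure p) where
  measure_univ := by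
    simp only [toMeasure, Measure.coe_finsetSum, Finset.sum_apply, Measure.smul_apply,
      measure_univ, smul_eq_mul, mul_one]
    rw [← ENNReal.ofReal_sum_of_nonneg (fun s _ => p.2.1 s), p.2.2, ENNReal.ofReal_one]

end Distributions

/-- Expectation of an extended-real random variable: positive part minus negative part. -/
def eexpect {Ω : Type*} [MeasurableSpace Ω] (μ : Measure Ω) (f : Ω → EReal) : EReal :=
  ((∫⁻ ω, (f ω).toENNReal ∂μ : ENNReal) : EReal) -
    ((∫⁻ ω, (-f ω).toENNReal ∂μ : ENNReal) : EReal)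

/-! ### Convex risk measures -/

/-- Convex risk measures on `ℝ^{|S|}`. -/
structure IsConvexRiskMeasure {S : Type*} (σ : (S → ℝ) → ℝ) : Prop where
  monotone : ∀ V' V : S → ℝ, V' ≤ V → σ V ≤ σ V'
  translation : ∀ (V : S → ℝ) (m : ℝ), σ (fun s => V s + m) = σ V - m
  convex : ∀ (V' V : S → ℝ) (l : ℝ), 0 ≤ l → l ≤ 1 →
    σ (fun s => l * V s + (1 - l) * V' s) ≤ l * σ V + (1 - l) * σ V'

/-! ### Markov decision processes -/

/-- A finite MDP `(S, A, P, r, γ, ρ)`. -/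
structure MDP (S A : Type*) [Fintype S] [Fintype A] where
  P : S → A → Simplex S
  r : S → A → ℝ
  r_nonneg : ∀ s a, 0 ≤ r s a
  r_le_one : ∀ s a, r s a ≤ 1
  γ : ℝ
  γ_nonneg : 0 ≤ γ
  γ_lt_one : γ < 1
  ρ : Simplex S

/-- A stationary stochastic policy. -/
abbrev StatPolicy (S A : Type*) [Fintype A] : Type _ := S → Simplex A

/-- A general policy: the law of `a_t` may depend on `t`, on the past
`(s_0, a_0), …, (s_{t-1}, a_{t-1})` and on the current state `s_t`. -/
abbrev Policy (S A : Type*) [Fintype A] : Type _ := (t : ℕ) → (Fin t → S × A) → S → Simplex A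

/-- Transition probabilities `P̂_{t;s,a}`, possibly varying with time; `s_{t+1} ∼ P̂_{t;s_t,a_t}`. -/
abbrev Transition (S A : Type*) [Fintype S] : Type _ := ℕ → S → A → Simplex S

/-- A deterministic stationary policy as a stochastic one. -/
def detPolicy {S A : Type*} [Fintype A] (f : S → A) : StatPolicy S A := fun s => point (f s)

/-- A stationary policy as a general policy. -/
def StatPolicy.toPolicy {S A : Type*} [Fintype A] (π : StatPolicy S A) : Policy S A :=
  fun _ _ s => π s

/-- A stationary transition model as a time-dependent one. -/
def statTransition {S A : Type*} [Fintype S] (K : S → A → Simplex S) : Transition S A := fun _ => K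

section Trajectory

variable {S A : Type*} [Fintype S] [Fintype A]
  [MeasurableSpace S] [MeasurableSingletonClass S]
  [MeasurableSpace A] [MeasurableSingletonClass A]

/-- Conditional law of `(s_{t+1}, a_{t+1})` given `(s_0, a_0), …, (s_t, a_t)`. -/
def stepKernel (π : Policy S A) (K : Transition S A) (t : ℕ) :
    Kernel ((i : Finset.Iic t) → (fun _ : ℕ => S × A) i) (S × A) :=
  Kernel.ofFunOfCountable fun h =>
    toMeasure (joint
      (K t (h ⟨t, Finset.mem_Iic.2 le_rfl⟩).1 (h ⟨t, Finset.mem_Iic.2 le_rfl⟩).2)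
      (π (t + 1) fun i : Fin (t + 1) => h ⟨i, Finset.mem_Iic.2 (Nat.lt_succ_iff.1 i.2)⟩))

instance (π : Policy S A) (K : Transition S A) (t : ℕ) : IsMarkovKernel (stepKernel π K t) where
  isProbabilityMeasure h := by
    change IsProbabilityMeasure (toMeasure _)
    infer_instance

/-- Law of the trajectory `(s_t, a_t)_{t ≥ 0}` when `(s_0, a_0) ∼ μ₀`. -/
def trajLaw (μ₀ : Simplex (S × A)) (π : Policy S A) (K : Transition S A) :
    Measure (ℕ → S × A) :=
  Kernel.trajMeasure (X := fun _ => S × A) (toMeasure μ₀) (stepKernel π K)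

end Trajectory

namespace MDP

variable {S A : Type*} [Fintype S] [Fintype A]

/-! ### The regularized robust MDP -/

section Robust

variable [MeasurableSpace S] [MeasurableSingletonClass S]
  [MeasurableSpace A] [MeasurableSingletonClass A]

/-- The discounted regularized reward `∑_t γ^t (r(s_t,a_t) + γ D(P̂_{t;s_t,a_t}, P_{s_t,a_t}))`
along a trajectory. -/
def total (M : MDP S A) (D : Simplex S → Simplex S → EReal) (K : Transition S A)
    (ω : ℕ → S × A) : EReal :=
  ∑' t : ℕ, ((M.γ ^ t : ℝ) : EReal) *
    ((M.r (ω t).1 (ω t).2 : EReal) +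
      (M.γ : EReal) * D (K t (ω t).1 (ω t).2) (M.P (ω t).1 (ω t).2))

/-- Expected discounted regularized reward from `s_0 = s`. -/
def objV (M : MDP S A) (D : Simplex S → Simplex S → EReal) (π : Policy S A) (K : Transition S A)
    (s : S) : EReal :=
  eexpect (trajLaw (joint (point s) (π 0 Fin.elim0)) π K) (M.total D K)

/-- Expected discounted regularized reward from `s_0 = s`, `a_0 = a`
(the policy is used from time `1` on). -/
def objQ (M : MDP S A) (D : Simplex S → Simplex S → EReal) (π : Policy S A) (K : Transition S A)
    (s : S) (a : A) : EReal :=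
  eexpect (trajLaw (point (s, a)) π K) (M.total D K)

/-- Optimal value function of the regularized robust MDP. -/
def robustVstar (M : MDP S A) (D : Simplex S → Simplex S → EReal) (s : S) : EReal :=
  ⨆ π : Policy S A, ⨅ K : Transition S A, M.objV D π K s

/-- Value function of a stationary policy in the regularized robust MDP. -/
def robustV (M : MDP S A) (D : Simplex S → Simplex S → EReal) (π : StatPolicy S A) (s : S) : EReal :=
  ⨅ K : Transition S A, M.objV D π.toPolicy K s

/-- Optimal Q-function of the regularized robust MDP. -/
def robustQstar (M : MDP S A) (D : Simplex S → Simplex S → EReal) (s : S) (a : A) : EReal :=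
  ⨆ π : Policy S A, ⨅ K : Transition S A, M.objQ D π K s a

/-- Q-function of a stationary policy in the regularized robust MDP. -/
def robustQ (M : MDP S A) (D : Simplex S → Simplex S → EReal) (π : StatPolicy S A)
    (s : S) (a : A) : EReal :=
  ⨅ K : Transition S A, M.objQ D π.toPolicy K s a

/-- `K` attains the infimum over transition models for the policy `π`, started at `s`. -/
def IsWorstCase (M : MDP S A) (D : Simplex S → Simplex S → EReal) (π : Policy S A)
    (K : Transition S A) (s : S) : Prop :=
  M.objV D π K s = ⨅ K' : Transition S A, M.objV D π K' s

/-- `(π, K)` solves the sup-inf problem started at `s`: `π` attains the outer supremum and `K`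
attains the inner infimum for `π`. -/
def IsSupInfSolution (M : MDP S A) (D : Simplex S → Simplex S → EReal) (π : Policy S A)
    (K : Transition S A) (s : S) : Prop :=
  (⨅ K' : Transition S A, M.objV D π K' s) = M.robustVstar D s ∧ M.IsWorstCase D π K s

end Robust

/-! ### The risk-sensitive MDP -/

section Risk

/-- The quantity `r(s,a) - γ σ(P_{s,a}, V)`. -/
def riskBackup (M : MDP S A) (σ : Simplex S → (S → ℝ) → ℝ) (V : S → ℝ) (s : S) (a : A) : ℝ :=
  M.r s a - M.γ * σ (M.P s a) V

/-- Fixed-point equation of the risk-sensitive value function of `π`. -/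
def IsRiskValue (M : MDP S A) (σ : Simplex S → (S → ℝ) → ℝ) (π : StatPolicy S A)
    (V : S → ℝ) : Prop :=
  ∀ s, V s = ∑ a, (π s).1 a * M.riskBackup σ V s a

/-- Fixed-point equation of the optimal risk-sensitive value function. -/
def IsRiskOptValue [Nonempty A] (M : MDP S A) (σ : Simplex S → (S → ℝ) → ℝ) (V : S → ℝ) : Prop :=
  ∀ s, V s = Finset.univ.sup' Finset.univ_nonempty (M.riskBackup σ V s)

/-- Risk-sensitive value function of `π`: the solution of its fixed-point equation. -/
def riskV (M : MDP S A) (σ : Simplex S → (S → ℝ) → ℝ) (π : StatPolicy S A) : S → ℝ :=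
  Classical.epsilon (M.IsRiskValue σ π)

/-- Optimal risk-sensitive value function: the solution of its fixed-point equation. -/
def riskVstar [Nonempty A] (M : MDP S A) (σ : Simplex S → (S → ℝ) → ℝ) : S → ℝ :=
  Classical.epsilon (M.IsRiskOptValue σ)

/-- Risk-sensitive Q-function of `π`. -/
def riskQ (M : MDP S A) (σ : Simplex S → (S → ℝ) → ℝ) (π : StatPolicy S A) (s : S) (a : A) : ℝ :=
  M.riskBackup σ (M.riskV σ π) s a

/-- Optimal risk-sensitive Q-function. -/
def riskQstar [Nonempty A] (M : MDP S A) (σ : Simplex S → (S → ℝ) → ℝ) (s : S) (a : A) : ℝ :=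
  M.riskBackup σ (M.riskVstar σ) s a

end Risk

/-- `f(s) ∈ argmax_a (r(s,a) - γ σ(P_{s,a}, V))` for every `s`. -/
def IsGreedy (M : MDP S A) (σ : Simplex S → (S → ℝ) → ℝ) (V : S → ℝ) (f : S → A) : Prop :=
  ∀ s a, M.riskBackup σ V s a ≤ M.riskBackup σ V s (f s)

/-- `K_{s,a} ∈ argmin_{P̂} (D(P̂, P_{s,a}) + E_{s' ∼ P̂} V(s'))` for every `s, a`. -/
def IsArgminKernel (M : MDP S A) (D : Simplex S → Simplex S → EReal) (V : S → ℝ)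
    (K : S → A → Simplex S) : Prop :=
  ∀ s a, ∀ p : Simplex S,
    D (K s a) (M.P s a) + (expect (K s a) V : EReal) ≤ D p (M.P s a) + (expect p V : EReal)

end MDP

end RMDP

end

open RMDP

/-! Everything rests on Fenchel duality and a telescoping sum. For any fixed V one has D(p, P) ≥
-σ(P, V) - E_p V (`le_penalty`), with equality for some p, because σ has at V a subgradient that is
minus a probability vector (`IsConvexRiskMeasure.exists_simplex`, from Hahn–Banach).

Replacing D by this bound turns the one-step reward into `gain`, the risk backup of V minus γ E_{P̂}
V, whose expected discounted sum telescopes. If V is the risk value of the policy, the sum equals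
the expected backup at time 0 whatever the transitions (`integral_tsum_gain_eq`); if V merely
dominates its backups, the sum is at most that, whatever the policy (`integral_tsum_gain_le`).

Hence V^π bounds J(π, ·) from below, and an argmin kernel attains the bound. For V* there is a
saddle point: a greedy policy secures V* against all transitions, and an argmin kernel holds every
history-dependent policy to V*. No Bellman equation for the robust problem is needed. -/

namespace RMDP

/-! ### Lipschitz bound and subgradients of convex risk measures. -/

section Duality

variable {S : Type*}

lemma IsConvexRiskMeasure.le_add_dist [Fintype S] {σ : (S → ℝ) → ℝ} (h : IsConvexRiskMeasure σ)
    (V V' : S → ℝ) : σ V ≤ σ V' + dist V V' := by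
  have h1 : σ V ≤ σ (fun s => V' s + -dist V V') := by
    refine h.monotone _ _ fun s => ?_
    have := (abs_le.1 ((Real.dist_eq _ _).symm.le.trans (dist_le_pi_dist V V' s))).1
    dsimp only
    linarith
  rw [h.translation] at h1
  linarith

lemma IsConvexRiskMeasure.continuous [Fintype S] {σ : (S → ℝ) → ℝ} (h : IsConvexRiskMeasure σ) :
    Continuous σ := by
  refine (LipschitzWith.of_dist_le_mul (K := 1) fun V V' => ?_).continuous
  have h1 := h.le_add_dist V V'
  have h2 := h.le_add_dist V' V
  rw [dist_comm] at h2
  rw [Real.dist_eq, abs_le, NNReal.coe_one, one_mul]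
  constructor <;> linarith

/-- A convex risk measure has a subgradient at every point, given by minus a probability
distribution. -/
lemma IsConvexRiskMeasure.exists_simplex [Fintype S] {σ : (S → ℝ) → ℝ}
    (h : IsConvexRiskMeasure σ) (V : S → ℝ) :
    ∃ p : Simplex S, ∀ X, -σ X - expect p X ≤ -σ V - expect p V := by
  classical
  -- The strict epigraph of σ is convex and open, so a hyperplane separates it from the boundary
  -- point (V, σ V).
  have hconv : Convex ℝ {x : (S → ℝ) × ℝ | σ x.1 < x.2} := by
    rintro ⟨X, a⟩ hX ⟨Y, b⟩ hY u v hu hv huv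
    simp only [Set.mem_ofPred_eq] at hX hY
    have hv' : v = 1 - u := by linarith
    have hc := h.convex Y X u hu (by linarith)
    have : (u • (X, a) + v • (Y, b) : (S → ℝ) × ℝ)
        = (fun s => u * X s + (1 - u) * Y s, u * a + v * b) := by
      subst hv'; rfl
    rw [this]
    simp only [Set.mem_ofPred_eq]
    refine hc.trans_lt ?_
    rw [← hv']
    -- For u = 0 the strict inequality has to come from the second point.
    rcases hu.eq_or_lt with rfl | hu0
    · have : v = 1 := by linarith
      subst this; linarith
    · nlinarith [mul_lt_mul_of_pos_left hX hu0, mul_le_mul_of_nonneg_left hY.le hv]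
  have hopen : IsOpen {x : (S → ℝ) × ℝ | σ x.1 < x.2} :=
    isOpen_lt (h.continuous.comp continuous_fst) continuous_snd
  obtain ⟨f, hf⟩ := geometric_hahn_banach_open_point (x := (V, σ V)) hconv hopen
    (by simp)
  have hdec : ∀ (X : S → ℝ) (t : ℝ), f (X, t) = f (X, 0) + t * f (0, 1) := by
    intro X t
    rw [← smul_eq_mul, ← map_smul, ← map_add]
    simp
  set c := f (0, 1) with hc
  -- The hyperplane is not vertical, so dividing by -c makes it the graph of an affine function with
  -- linear part `l`.
  have hc0 : c < 0 := by
    have := hf (V, σ V + 1) (by simp)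
    rw [hdec, hdec V (σ V)] at this
    linarith
  let l : (S → ℝ) →ₗ[ℝ] ℝ := (-c)⁻¹ • (f.toLinearMap ∘ₗ LinearMap.inl ℝ (S → ℝ) ℝ)
  have hl : ∀ X, l X = (-c)⁻¹ * f (X, 0) := fun X => rfl
  -- `l` is a subgradient of σ at V; ε compensates for the strictness of the epigraph.
  have key : ∀ X, l X - σ X ≤ l V - σ V := by
    intro X
    refine le_of_forall_pos_lt_add fun ε hε => ?_
    have h1 := hf (X, σ X + ε) (by simpa using hε)
    rw [hdec, hdec V (σ V)] at h1
    rw [hl, hl]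
    have hcn : -c ≠ 0 := neg_ne_zero.2 hc0.ne
    have hm : f (X, 0) = -c * ((-c)⁻¹ * f (X, 0)) := (mul_inv_cancel_left₀ hcn _).symm
    have hm' : f (V, 0) = -c * ((-c)⁻¹ * f (V, 0)) := (mul_inv_cancel_left₀ hcn _).symm
    rw [hm, hm'] at h1
    have hcp : 0 < -c := by linarith
    refine lt_of_mul_lt_mul_left ?_ hcp.le
    linarith
  -- Translating V by ±1 fixes the total mass of -`l`; monotonicity then makes its coefficients
  -- nonnegative.
  have hone : l (fun _ => 1) = -1 := by
    have e1 : (fun s => V s + 1) = V + fun _ => (1 : ℝ) := rfl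
    have e2 : (fun s => V s + -1) = V - fun _ => (1 : ℝ) := rfl
    have k1 := key (fun s => V s + 1)
    have k2 := key (fun s => V s + -1)
    rw [h.translation, e1, map_add] at k1
    rw [h.translation, e2, map_sub] at k2
    linarith
  have hneg : ∀ s, l (Pi.single s 1) ≤ 0 := by
    intro s
    have k1 := key (V + Pi.single s 1)
    have k2 := h.monotone V (V + Pi.single s 1)
      (le_add_of_nonneg_right (Pi.single_nonneg.2 zero_le_one))
    rw [map_add] at k1
    linarith
  have hsum : ∀ X, l X = ∑ s, X s * l (Pi.single s 1) := fun X => by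
    rw [LinearMap.pi_apply_eq_sum_univ l X]
    refine Finset.sum_congr rfl fun s _ => ?_
    rw [smul_eq_mul]
    congr 2
    ext j
    simp [Pi.single_apply, eq_comm]
  let p : Simplex S := ⟨fun s => -l (Pi.single s 1), fun s => by linarith [hneg s], by
    have := hsum fun _ => 1
    simp only [one_mul] at this
    rw [Finset.sum_neg_distrib, ← this, hone, neg_neg]⟩
  have hp : ∀ X, expect p X = -l X := fun X => by
    simp only [expect, p]
    rw [hsum, ← Finset.sum_neg_distrib]
    exact Finset.sum_congr rfl fun s _ => by ring
  refine ⟨p, fun X => ?_⟩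
  rw [hp, hp]
  linarith [key X]

end Duality

/-! ### Contractions in the sup norm. -/

section FixedPoint

variable {S : Type*} [Fintype S]

/-- Banach's fixed point theorem for sup-norm contractions on `ℝ^S`. -/
lemma existsUnique_fixedPoint {γ : ℝ} (h0 : 0 ≤ γ) (h1 : γ < 1) (T : (S → ℝ) → S → ℝ)
    (hT : ∀ V V' s, T V s ≤ T V' s + γ * dist V V') : ∃! V : S → ℝ, ∀ s, V s = T V s := by
  have hc : ContractingWith ⟨γ, h0⟩ T := by
    refine ⟨by exact_mod_cast h1, LipschitzWith.of_dist_le_mul fun V V' => ?_⟩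
    refine (dist_pi_le_iff (mul_nonneg h0 dist_nonneg)).2 fun s => ?_
    have h1 := hT V V' s
    have h2 := hT V' V s
    rw [dist_comm] at h2
    rw [Real.dist_eq, abs_le]
    change -(γ * _) ≤ _ ∧ _ ≤ γ * _
    constructor <;> linarith
  refine ⟨hc.fixedPoint, fun s => (congrFun hc.fixedPoint_isFixedPt s).symm, fun V hV => ?_⟩
  exact hc.fixedPoint_unique (funext fun s => (hV s).symm)

end FixedPoint

/-! ### Risk-sensitive fixed points and minimisers of the penalty. -/

namespace MDP

variable {S A : Type*} [Fintype S] [Fintype A] {M : MDP S A} {σ : Simplex S → (S → ℝ) → ℝ}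

lemma riskBackup_le_add (hσ : ∀ s a, IsConvexRiskMeasure (σ (M.P s a))) (V V' : S → ℝ)
    (s : S) (a : A) : M.riskBackup σ V s a ≤ M.riskBackup σ V' s a + M.γ * dist V V' := by
  have h := mul_le_mul_of_nonneg_left ((hσ s a).le_add_dist V' V) M.γ_nonneg
  rw [dist_comm] at h
  simp only [riskBackup]
  linarith

lemma existsUnique_isRiskValue (hσ : ∀ s a, IsConvexRiskMeasure (σ (M.P s a)))
    (π : StatPolicy S A) : ∃! V : S → ℝ, M.IsRiskValue σ π V := by
  refine existsUnique_fixedPoint M.γ_nonneg M.γ_lt_one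
    (fun V s => ∑ a, (π s).1 a * M.riskBackup σ V s a) fun V V' s => ?_
  have : M.γ * dist V V' = ∑ a, (π s).1 a * (M.γ * dist V V') := by
    rw [← Finset.sum_mul, (π s).2.2, one_mul]
  rw [this, ← Finset.sum_add_distrib]
  refine Finset.sum_le_sum fun a _ => ?_
  rw [← mul_add]
  exact mul_le_mul_of_nonneg_left (riskBackup_le_add hσ V V' s a) ((π s).2.1 a)

lemma existsUnique_isRiskOptValue [Nonempty A] (hσ : ∀ s a, IsConvexRiskMeasure (σ (M.P s a))) :
    ∃! V : S → ℝ, M.IsRiskOptValue σ V := by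
  refine existsUnique_fixedPoint M.γ_nonneg M.γ_lt_one
    (fun V s => Finset.univ.sup' Finset.univ_nonempty (M.riskBackup σ V s)) fun V V' s => ?_
  refine Finset.sup'_le _ _ fun a ha => (riskBackup_le_add hσ V V' s a).trans ?_
  gcongr
  exact Finset.le_sup' (M.riskBackup σ V' s) ha

lemma isRiskValue_riskV (hσ : ∀ s a, IsConvexRiskMeasure (σ (M.P s a)))
    (π : StatPolicy S A) : M.IsRiskValue σ π (M.riskV σ π) :=
  Classical.epsilon_spec (existsUnique_isRiskValue hσ π).exists

lemma isRiskOptValue_riskVstar [Nonempty A] (hσ : ∀ s a, IsConvexRiskMeasure (σ (M.P s a))) :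
    M.IsRiskOptValue σ (M.riskVstar σ) :=
  Classical.epsilon_spec (existsUnique_isRiskOptValue hσ).exists

lemma IsRiskOptValue.riskBackup_le [Nonempty A] {V : S → ℝ} (hV : M.IsRiskOptValue σ V) (s : S)
    (a : A) : M.riskBackup σ V s a ≤ V s :=
  (hV s).symm ▸ Finset.le_sup' (M.riskBackup σ V s) (Finset.mem_univ a)

lemma exists_isGreedy [Nonempty A] (V : S → ℝ) : ∃ f : S → A, M.IsGreedy σ V f := by
  choose f hf using fun s => Finite.exists_max (M.riskBackup σ V s)
  exact ⟨f, hf⟩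

lemma sum_point_mul (a : A) (g : A → ℝ) : ∑ b, (point a).1 b * g b = g a := by
  classical
  simp only [point]
  rw [Finset.sum_eq_single a]
  · simp
  · intro b _ hb
    simp [hb]
  · simp

/-- Greedy actions attain the maximum, so V* is itself the value of a stationary policy and the
single-policy results apply to it. -/
lemma IsGreedy.isRiskValue [Nonempty A] {V : S → ℝ} {f : S → A} (hV : M.IsRiskOptValue σ V)
    (hf : M.IsGreedy σ V f) : M.IsRiskValue σ (detPolicy f) V := fun s => by
  rw [detPolicy, sum_point_mul]
  refine le_antisymm ?_ (hV.riskBackup_le s (f s))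
  exact (hV s).le.trans (Finset.sup'_le _ _ fun a _ => hf s a)

variable {D : Simplex S → Simplex S → EReal}

lemma le_penalty (hD : ∀ s a, ∀ p : Simplex S, D p (M.P s a) =
      ⨆ V : S → ℝ, ((-σ (M.P s a) V - expect p V : ℝ) : EReal)) (V : S → ℝ) (s : S) (a : A)
    (p : Simplex S) : ((-σ (M.P s a) V - expect p V : ℝ) : EReal) ≤ D p (M.P s a) :=
  (le_iSup (fun V : S → ℝ => ((-σ (M.P s a) V - expect p V : ℝ) : EReal)) V).trans_eq
    (hD s a p).symm

/-- At the distribution given by a subgradient at V, the supremum defining the penalty is attained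
at V. -/
lemma exists_penalty_eq (hσ : ∀ s a, IsConvexRiskMeasure (σ (M.P s a)))
    (hD : ∀ s a, ∀ p : Simplex S, D p (M.P s a) =
      ⨆ V : S → ℝ, ((-σ (M.P s a) V - expect p V : ℝ) : EReal)) (V : S → ℝ) (s : S) (a : A) :
    ∃ p : Simplex S, D p (M.P s a) = ((-σ (M.P s a) V - expect p V : ℝ) : EReal) := by
  obtain ⟨p, hp⟩ := (hσ s a).exists_simplex V
  refine ⟨p, le_antisymm ?_ (le_penalty hD V s a p)⟩
  rw [hD]
  exact iSup_le fun X => EReal.coe_le_coe_iff.2 (hp X)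

lemma exists_isArgminKernel (hσ : ∀ s a, IsConvexRiskMeasure (σ (M.P s a)))
    (hD : ∀ s a, ∀ p : Simplex S, D p (M.P s a) =
      ⨆ V : S → ℝ, ((-σ (M.P s a) V - expect p V : ℝ) : EReal)) (V : S → ℝ) :
    ∃ K : S → A → Simplex S, M.IsArgminKernel D V K := by
  choose K hK using exists_penalty_eq hσ hD V
  refine ⟨K, fun s a p => ?_⟩
  refine le_trans ?_ (add_le_add_left (le_penalty hD V s a p) _)
  rw [hK, ← EReal.coe_add, ← EReal.coe_add, sub_add_cancel, sub_add_cancel]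

/-- The minimum of D(p, P) + E_p V is exactly -σ(P, V), so every minimiser, not just one built from
a subgradient, gives equality in the Fenchel bound and has finite penalty. -/
lemma IsArgminKernel.penalty_eq (hσ : ∀ s a, IsConvexRiskMeasure (σ (M.P s a)))
    (hD : ∀ s a, ∀ p : Simplex S, D p (M.P s a) =
      ⨆ V : S → ℝ, ((-σ (M.P s a) V - expect p V : ℝ) : EReal)) {V : S → ℝ}
    {K : S → A → Simplex S} (hK : M.IsArgminKernel D V K) (s : S) (a : A) :
    D (K s a) (M.P s a) = ((-σ (M.P s a) V - expect (K s a) V : ℝ) : EReal) := by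
  refine le_antisymm ?_ (le_penalty hD V s a _)
  obtain ⟨p, hp⟩ := exists_penalty_eq hσ hD V s a
  have h := hK s a p
  rw [hp, ← EReal.coe_add, sub_add_cancel] at h
  rw [EReal.coe_sub]
  exact (EReal.le_sub_iff_add_le (.inl (EReal.coe_ne_bot _)) (.inl (EReal.coe_ne_top _))).2 h

end MDP

end RMDP

namespace RMDP

open Filter Topology

/-! ### Series and expectations in the extended reals. -/

section ExtendedReal

lemma hasSum_coe_ereal {f : ℕ → ℝ} (hf : Summable f) :
    HasSum (fun t => (f t : EReal)) ((∑' t, f t : ℝ) : EReal) := by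
  let φ : ℝ →+ EReal := ⟨⟨Real.toEReal, EReal.coe_zero⟩, EReal.coe_add⟩
  exact hf.hasSum.map φ continuous_coe_real_ereal

/-- A series of extended reals that dominates a summable real series converges, and its sum
dominates. -/
lemma coe_tsum_le_tsum_ereal {f : ℕ → ℝ} (hf : Summable f) {x : ℕ → EReal}
    (hx : ∀ t, (f t : EReal) ≤ x t) : ((∑' t, f t : ℝ) : EReal) ≤ ∑' t, x t := by
  -- The excess over `f` is a nonnegative series, which always converges in [0, ∞]. Thus `x` really
  -- has a sum, and its `tsum` is not the default 0.
  let y : ℕ → ENNReal := fun t => (x t - f t).toENNReal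
  have hy : ∀ t, (y t : EReal) = x t - f t := fun t =>
    EReal.coe_toENNReal ((EReal.sub_nonneg (.inr (EReal.coe_ne_top _))
      (.inr (EReal.coe_ne_bot _))).2 (hx t))
  have hxy : ∀ t, x t = f t + (y t : EReal) := fun t => by
    rw [hy, add_comm, EReal.sub_add_cancel]
  have hys : HasSum (fun t => (y t : EReal)) ((∑' t, y t : ENNReal) : EReal) := by
    let φ : ENNReal →+ EReal := ⟨⟨ENNReal.toEReal, EReal.coe_ennreal_zero⟩, EReal.coe_ennreal_add⟩
    exact (ENNReal.summable (f := y)).hasSum.map φ continuous_coe_ennreal_ereal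
  have hsum : HasSum x (((∑' t, f t : ℝ) : EReal) + ((∑' t, y t : ENNReal) : EReal)) := by
    have hc := EReal.continuousAt_add
      (p := (((∑' t, f t : ℝ) : EReal), ((∑' t, y t : ENNReal) : EReal)))
      (.inl (EReal.coe_ne_top _)) (.inl (EReal.coe_ne_bot _))
    have h := hc.tendsto.comp ((hasSum_coe_ereal hf).prodMk_nhds hys)
    refine h.congr fun s => ?_
    simp only [Function.comp, ← Finset.sum_add_distrib, hxy]
  rw [hsum.tsum_eq]
  exact le_add_of_nonneg_right (EReal.coe_ennreal_nonneg _)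

variable {Ω : Type*} [MeasurableSpace Ω] {μ : Measure Ω}

/-- Lower integrals are monotone for arbitrary functions, so the total reward never has to be shown
measurable. -/
lemma eexpect_mono {f g : Ω → EReal} (h : ∀ ω, f ω ≤ g ω) : eexpect μ f ≤ eexpect μ g := by
  refine EReal.sub_le_sub ?_ ?_
  · exact_mod_cast lintegral_mono fun ω => EReal.toENNReal_le_toENNReal (h ω)
  · exact_mod_cast lintegral_mono fun ω =>
      EReal.toENNReal_le_toENNReal (EReal.neg_le_neg_iff.2 (h ω))

lemma eexpect_coe {f : Ω → ℝ} (hf : Integrable f μ) :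
    eexpect μ (fun ω => (f ω : EReal)) = ((∫ ω, f ω ∂μ : ℝ) : EReal) := by
  have h1 : ∫⁻ ω, ENNReal.ofReal (f ω) ∂μ ≠ ⊤ := hf.lintegral_lt_top.ne
  have h2 : ∫⁻ ω, ENNReal.ofReal (-f ω) ∂μ ≠ ⊤ := hf.neg.lintegral_lt_top.ne
  rw [integral_eq_lintegral_pos_part_sub_lintegral_neg_part hf, EReal.coe_sub,
    EReal.coe_ennreal_toReal h1, EReal.coe_ennreal_toReal h2]
  rfl

end ExtendedReal

/-! ### Initial law and Markov property of the trajectory. -/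

section Trajectory

variable {S A : Type*} [Fintype S] [Fintype A]

lemma integral_toMeasure [MeasurableSpace S] [MeasurableSingletonClass S] (p : Simplex S)
    (g : S → ℝ) : ∫ s, g s ∂toMeasure p = ∑ s, p.1 s * g s := by
  have : ∀ s ∈ Finset.univ, Integrable g (ENNReal.ofReal (p.1 s) • Measure.dirac s) :=
    fun s _ => (integrable_dirac (by simp)).smul_measure ENNReal.ofReal_ne_top
  rw [toMeasure, integral_finsetSum_measure this]
  refine Finset.sum_congr rfl fun s _ => ?_
  rw [integral_smul_measure, integral_dirac, ENNReal.toReal_ofReal (p.2.1 s), smul_eq_mul]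

lemma sum_joint_mul (p : Simplex S) (q : S → Simplex A) (g : S × A → ℝ) :
    ∑ x, (joint p q).1 x * g x = ∑ s, p.1 s * ∑ a, (q s).1 a * g (s, a) := by
  rw [Fintype.sum_prod_type]
  simp only [joint, Finset.mul_sum, mul_assoc]

variable [MeasurableSpace S] [MeasurableSingletonClass S]
  [MeasurableSpace A] [MeasurableSingletonClass A]
  (μ₀ : Simplex (S × A)) (π : Policy S A) (K : Transition S A)

instance : IsProbabilityMeasure (trajLaw μ₀ π K) := by
  unfold trajLaw; infer_instance

lemma integrable_trajLaw_eval (g : S × A → ℝ) (t : ℕ) :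
    Integrable (fun ω => g (ω t)) (trajLaw μ₀ π K) := by
  refine Integrable.of_bound (C := ∑ x, ‖g x‖) ?_ (ae_of_all _ fun ω => ?_)
  · exact ((measurable_of_finite g).comp (measurable_pi_apply t)).aestronglyMeasurable
  · exact Finset.single_le_sum (f := fun x => ‖g x‖) (fun x _ => norm_nonneg _)
      (Finset.mem_univ _)

lemma trajLaw_map_zero : (trajLaw μ₀ π K).map (fun ω => ω 0) = toMeasure μ₀ := by
  have hf : (fun ω : ℕ → S × A => ω 0) =
      (MeasurableEquiv.piUnique (fun _ : Finset.Iic 0 => S × A)) ∘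
        (Preorder.frestrictLe (π := fun _ : ℕ => S × A) 0) := rfl
  rw [trajLaw, Kernel.trajMeasure, hf, ← Measure.map_map (by fun_prop) (by fun_prop),
    Measure.map_comp _ _ (by fun_prop), Kernel.traj_map_frestrictLe, Kernel.partialTraj_self,
    Measure.id_comp, Measure.map_map (by fun_prop) (by fun_prop)]
  exact (congrArg (Measure.map · _) (MeasurableEquiv.self_comp_symm _)).trans Measure.map_id

lemma integral_trajLaw_zero (g : S × A → ℝ) :
    ∫ ω, g (ω 0) ∂trajLaw μ₀ π K = ∑ x, μ₀.1 x * g x := by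
  rw [← integral_toMeasure, ← trajLaw_map_zero μ₀ π K, integral_map (measurable_pi_apply 0).aemeasurable]
  exact (measurable_of_finite g).aestronglyMeasurable

lemma integral_stepKernel (g : S × A → ℝ) (t : ℕ) (ω : ℕ → S × A) :
    ∫ x, g x ∂stepKernel π K t (Preorder.frestrictLe t ω) =
      ∑ s, (K t (ω t).1 (ω t).2).1 s * ∑ a, (π (t + 1) (fun i => ω i) s).1 a * g (s, a) := by
  change ∫ x, g x ∂toMeasure _ = _
  rw [integral_toMeasure, sum_joint_mul]
  rfl

/-- Markov property: the expectation at time `t + 1` is that of the one-step conditional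
expectation at time `t`. -/
lemma integral_trajLaw_succ (g : S × A → ℝ) (t : ℕ) :
    ∫ ω, g (ω (t + 1)) ∂trajLaw μ₀ π K =
      ∫ ω, (∑ s, (K t (ω t).1 (ω t).2).1 s *
        ∑ a, (π (t + 1) (fun i => ω i) s).1 a * g (s, a)) ∂trajLaw μ₀ π K := by
  have hm : Measurable g := measurable_of_finite g
  have hr : Measurable (Preorder.frestrictLe (π := fun _ : ℕ => S × A) t) := by fun_prop
  have hp : Measurable fun ω : ℕ → S × A => (Preorder.frestrictLe t ω, ω (t + 1)) := by fun_prop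
  -- The joint law of the history up to t and the next pair is a composition-product, so the next
  -- pair can be integrated out first.
  have h := Kernel.map_frestrictLe_trajMeasure_compProd_eq_map_trajMeasure
    (X := fun _ => S × A) (μ₀ := toMeasure μ₀) (κ := stepKernel π K) (a := t)
  have hg : AEStronglyMeasurable (fun x : ((i : Finset.Iic t) → S × A) × (S × A) => g x.2)
      ((trajLaw μ₀ π K).map fun ω => (Preorder.frestrictLe t ω, ω (t + 1))) :=
    (hm.comp measurable_snd).aestronglyMeasurable
  have hint : Integrable (fun x : ((i : Finset.Iic t) → S × A) × (S × A) => g x.2)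
      ((trajLaw μ₀ π K).map fun ω => (Preorder.frestrictLe t ω, ω (t + 1))) :=
    (integrable_map_measure hg hp.aemeasurable).2 (integrable_trajLaw_eval μ₀ π K g (t + 1))
  have h1 := integral_map hp.aemeasurable hg
  rw [trajLaw, ← h] at hint h1
  rw [Measure.integral_compProd hint, integral_map hr.aemeasurable
    (measurable_of_countable _).aestronglyMeasurable] at h1
  simp only [integral_stepKernel] at h1
  exact h1.symm

end Trajectory

end RMDP

namespace RMDP

open Filter Topology

lemma abs_expect_le {S : Type*} [Fintype S] (p : Simplex S) (V : S → ℝ) :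
    |expect p V| ≤ ∑ s, |V s| := by
  refine (Finset.abs_sum_le_sum_abs _ _).trans (Finset.sum_le_sum fun s hs => ?_)
  rw [abs_mul, abs_of_nonneg (p.2.1 s)]
  refine mul_le_of_le_one_left (abs_nonneg _) ?_
  rw [← p.2.2]
  exact Finset.single_le_sum (fun s _ => p.2.1 s) hs

/-! ### Discounted telescoping sums. -/

section Telescoping

variable {γ : ℝ} {B W : ℕ → ℝ} {C : ℝ}

lemma summable_pow_mul_of_bounded (h0 : 0 ≤ γ) (h1 : γ < 1) {x : ℕ → ℝ} (hx : ∀ t, |x t| ≤ C) :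
    Summable fun t => γ ^ t * x t := by
  refine ((summable_geometric_of_lt_one h0 h1).mul_right C).of_norm_bounded fun t => ?_
  rw [norm_mul, Real.norm_of_nonneg (pow_nonneg h0 t)]
  exact mul_le_mul_of_nonneg_left (hx t) (pow_nonneg h0 t)

lemma tsum_discounted_telescope (h0 : 0 ≤ γ) (h1 : γ < 1) (hB : ∀ t, |B t| ≤ C) :
    ∑' t, γ ^ t * (B t - γ * B (t + 1)) = B 0 := by
  have hs := summable_pow_mul_of_bounded h0 h1 hB
  have e : ∀ t, γ ^ t * (B t - γ * B (t + 1)) = γ ^ t * B t - γ ^ (t + 1) * B (t + 1) :=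
    fun t => by ring
  simp only [e]
  rw [hs.tsum_sub ((summable_nat_add_iff 1).2 hs), hs.tsum_eq_zero_add]
  simp

/-- In the application B t is the expected backup at time t and W t the expected value of V at the
next state; enlarging W beyond B (t + 1) only lowers the sum. -/
lemma tsum_discounted_le (h0 : 0 ≤ γ) (h1 : γ < 1) (hB : ∀ t, |B t| ≤ C)
    (hs : Summable fun t => γ ^ t * (B t - γ * W t)) (hW : ∀ t, B (t + 1) ≤ W t) :
    ∑' t, γ ^ t * (B t - γ * W t) ≤ B 0 := by
  have hs' : Summable fun t => γ ^ t * (B t - γ * B (t + 1)) := by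
    refine summable_pow_mul_of_bounded (C := C + γ * C) h0 h1 fun t =>
      (abs_sub _ _).trans (add_le_add (hB t) ?_)
    rw [abs_mul, abs_of_nonneg h0]
    exact mul_le_mul_of_nonneg_left (hB _) h0
  refine (hs.tsum_le_tsum (fun t => ?_) hs').trans_eq (tsum_discounted_telescope h0 h1 hB)
  have := mul_le_mul_of_nonneg_left (hW t) h0
  exact mul_le_mul_of_nonneg_left (by linarith) (pow_nonneg h0 t)

end Telescoping

/-! ### The Fenchel lower bound of the reward and its expectation. -/

namespace MDP

variable {S A : Type*} [Fintype S] [Fintype A] (M : MDP S A) (σ : Simplex S → (S → ℝ) → ℝ)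
  (V : S → ℝ)

/-- One-step reward `r - γ σ(P, V) - γ E_{P̂} V`: the regularized reward with the penalty replaced
by its Fenchel lower bound at `V`. -/
def gain (K : Transition S A) (t : ℕ) (x : S × A) : ℝ :=
  M.riskBackup σ V x.1 x.2 - M.γ * expect (K t x.1 x.2) V

lemma exists_abs_gain_le (K : Transition S A) : ∃ C, ∀ t x, |M.gain σ V K t x| ≤ C := by
  refine ⟨∑ x : S × A, |M.riskBackup σ V x.1 x.2| + M.γ * ∑ s, |V s|, fun t x =>
    (abs_sub _ _).trans (add_le_add ?_ ?_)⟩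
  · exact Finset.single_le_sum (f := fun x : S × A => |M.riskBackup σ V x.1 x.2|)
      (fun x _ => abs_nonneg _) (Finset.mem_univ x)
  · rw [abs_mul, abs_of_nonneg M.γ_nonneg]
    exact mul_le_mul_of_nonneg_left (abs_expect_le _ _) M.γ_nonneg

lemma summable_gain (K : Transition S A) (ω : ℕ → S × A) :
    Summable fun t => M.γ ^ t * M.gain σ V K t (ω t) := by
  obtain ⟨C, hC⟩ := M.exists_abs_gain_le σ V K
  exact summable_pow_mul_of_bounded M.γ_nonneg M.γ_lt_one fun t => hC t (ω t)

variable {M σ V} {D : Simplex S → Simplex S → EReal}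

lemma coe_gain (K : Transition S A) (t : ℕ) (x : S × A) :
    ((M.γ ^ t * M.gain σ V K t x : ℝ) : EReal) = ((M.γ ^ t : ℝ) : EReal) *
      ((M.r x.1 x.2 : EReal) +
        (M.γ : EReal) * ((-σ (M.P x.1 x.2) V - expect (K t x.1 x.2) V : ℝ) : EReal)) := by
  rw [← EReal.coe_mul, ← EReal.coe_add, ← EReal.coe_mul, gain, riskBackup]
  congr 2
  ring

lemma coe_tsum_gain_le_total (K : Transition S A) (hD : ∀ s a, ∀ p : Simplex S, D p (M.P s a) =
      ⨆ V : S → ℝ, ((-σ (M.P s a) V - expect p V : ℝ) : EReal)) (ω : ℕ → S × A) :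
    ((∑' t, M.γ ^ t * M.gain σ V K t (ω t) : ℝ) : EReal) ≤ M.total D K ω := by
  refine coe_tsum_le_tsum_ereal (M.summable_gain σ V K ω) fun t => ?_
  rw [coe_gain]
  refine mul_le_mul_of_nonneg_left (add_le_add_right ?_ _)
    (EReal.coe_nonneg.2 (pow_nonneg M.γ_nonneg t))
  exact mul_le_mul_of_nonneg_left (le_penalty hD V _ _ _) (EReal.coe_nonneg.2 M.γ_nonneg)

/-- Equality in the Fenchel bound at each step makes the whole total real-valued on every
trajectory. -/
lemma IsArgminKernel.total_eq (hσ : ∀ s a, IsConvexRiskMeasure (σ (M.P s a)))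
    (hD : ∀ s a, ∀ p : Simplex S, D p (M.P s a) =
      ⨆ V : S → ℝ, ((-σ (M.P s a) V - expect p V : ℝ) : EReal))
    {K : S → A → Simplex S} (hK : M.IsArgminKernel D V K) (ω : ℕ → S × A) :
    M.total D (statTransition K) ω =
      ((∑' t, M.γ ^ t * M.gain σ V (statTransition K) t (ω t) : ℝ) : EReal) := by
  rw [← (hasSum_coe_ereal (M.summable_gain σ V (statTransition K) ω)).tsum_eq]
  refine tsum_congr fun t => ?_
  rw [coe_gain]
  simp only [statTransition, hK.penalty_eq hσ hD]

lemma sum_joint_point_mul (s : S) (q : S → Simplex A) (g : S → A → ℝ) :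
    ∑ x, (joint (point s) q).1 x * g x.1 x.2 = ∑ a, (q s).1 a * g s a := by
  rw [sum_joint_mul _ _ fun x => g x.1 x.2, sum_point_mul]

variable (M σ V)

variable [MeasurableSpace S] [MeasurableSingletonClass S]
  [MeasurableSpace A] [MeasurableSingletonClass A]
  (μ₀ : Simplex (S × A)) (π : Policy S A) (K : Transition S A)

lemma integrable_tsum_gain :
    Integrable (fun ω => ∑' t, M.γ ^ t * M.gain σ V K t (ω t)) (trajLaw μ₀ π K) := by
  obtain ⟨C, hC⟩ := M.exists_abs_gain_le σ V K
  have hm : Measurable fun ω : ℕ → S × A => ∑' t, M.γ ^ t * M.gain σ V K t (ω t) := by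
    have hf : ∀ n, Measurable fun ω : ℕ → S × A =>
        ∑ t ∈ Finset.range n, M.γ ^ t * M.gain σ V K t (ω t) := fun n =>
      Finset.measurable_fun_sum _ fun t _ =>
        ((measurable_of_finite (M.gain σ V K t)).comp (measurable_pi_apply t)).const_mul _
    refine measurable_of_tendsto_metrizable hf (tendsto_pi_nhds.2 fun ω => ?_)
    exact (M.summable_gain σ V K ω).hasSum.tendsto_sum_nat
  refine Integrable.of_bound hm.aestronglyMeasurable (C := (1 - M.γ)⁻¹ * C)
    (ae_of_all _ fun ω => ?_)
  refine tsum_of_norm_bounded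
    ((hasSum_geometric_of_lt_one M.γ_nonneg M.γ_lt_one).mul_right C) fun t => ?_
  rw [norm_mul, Real.norm_of_nonneg (pow_nonneg M.γ_nonneg t)]
  exact mul_le_mul_of_nonneg_left (hC t (ω t)) (pow_nonneg M.γ_nonneg t)

lemma integral_gain (t : ℕ) :
    ∫ ω, M.gain σ V K t (ω t) ∂trajLaw μ₀ π K =
      (∫ ω, M.riskBackup σ V (ω t).1 (ω t).2 ∂trajLaw μ₀ π K) -
        M.γ * ∫ ω, expect (K t (ω t).1 (ω t).2) V ∂trajLaw μ₀ π K := by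
  simp only [gain]
  rw [integral_sub (integrable_trajLaw_eval μ₀ π K (fun x => M.riskBackup σ V x.1 x.2) t)
    ((integrable_trajLaw_eval μ₀ π K (fun x => expect (K t x.1 x.2) V) t).const_mul _),
    integral_const_mul]

lemma hasSum_integral_gain :
    HasSum (fun t => M.γ ^ t * ((∫ ω, M.riskBackup σ V (ω t).1 (ω t).2 ∂trajLaw μ₀ π K) -
        M.γ * ∫ ω, expect (K t (ω t).1 (ω t).2) V ∂trajLaw μ₀ π K))
      (∫ ω, ∑' t, M.γ ^ t * M.gain σ V K t (ω t) ∂trajLaw μ₀ π K) := by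
  obtain ⟨C, hC⟩ := M.exists_abs_gain_le σ V K
  have hint : ∀ t, Integrable (fun ω => M.γ ^ t * M.gain σ V K t (ω t)) (trajLaw μ₀ π K) :=
    fun t => (integrable_trajLaw_eval μ₀ π K _ t).const_mul _
  have h := hasSum_integral_of_summable_integral_norm hint ?_
  · simpa only [integral_const_mul, integral_gain] using h
  · refine ((summable_geometric_of_lt_one M.γ_nonneg M.γ_lt_one).mul_right C).of_nonneg_of_le
      (fun t => integral_nonneg fun ω => norm_nonneg _) fun t => ?_
    refine (integral_mono (hint t).norm (integrable_const (M.γ ^ t * C)) fun ω => ?_).trans_eq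
      (by simp)
    dsimp only
    rw [norm_mul, Real.norm_of_nonneg (pow_nonneg M.γ_nonneg t)]
    exact mul_le_mul_of_nonneg_left (hC t (ω t)) (pow_nonneg M.γ_nonneg t)

lemma exists_abs_integral_riskBackup_le :
    ∃ C, ∀ t, |∫ ω, M.riskBackup σ V (ω t).1 (ω t).2 ∂trajLaw μ₀ π K| ≤ C := by
  refine ⟨∑ x : S × A, |M.riskBackup σ V x.1 x.2|, fun t => ?_⟩
  have h := norm_integral_le_of_norm_le_const (μ := trajLaw μ₀ π K)
    (f := fun ω => M.riskBackup σ V (ω t).1 (ω t).2)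
    (C := ∑ x : S × A, |M.riskBackup σ V x.1 x.2|) (ae_of_all _ fun ω => ?_)
  · rwa [probReal_univ, mul_one] at h
  exact Finset.single_le_sum (f := fun x : S × A => |M.riskBackup σ V x.1 x.2|)
    (fun x _ => abs_nonneg _) (Finset.mem_univ (ω t))

lemma integral_expect (t : ℕ) :
    ∫ ω, expect (K t (ω t).1 (ω t).2) V ∂trajLaw μ₀ π K =
      ∫ ω, V (ω (t + 1)).1 ∂trajLaw μ₀ π K := by
  rw [integral_trajLaw_succ μ₀ π K (fun x => V x.1)]
  simp only [← Finset.sum_mul, (π _ _ _).2.2, one_mul, expect]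

variable {M σ V π}

/-- Averaging the backup at time t + 1 over the action gives V at the new state, so the expected
gain is B t - γ B (t + 1). The condition concerns only times from 1 on, which leaves the initial
action free for the Q-functions. -/
lemma integral_tsum_gain_eq
    (hV : ∀ t h s, ∑ a, (π (t + 1) h s).1 a * M.riskBackup σ V s a = V s) :
    ∫ ω, ∑' t, M.γ ^ t * M.gain σ V K t (ω t) ∂trajLaw μ₀ π K =
      ∑ x, μ₀.1 x * M.riskBackup σ V x.1 x.2 := by
  obtain ⟨C, hC⟩ := M.exists_abs_integral_riskBackup_le σ V μ₀ π K
  rw [← (M.hasSum_integral_gain σ V μ₀ π K).tsum_eq,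
    ← integral_trajLaw_zero μ₀ π K (fun x => M.riskBackup σ V x.1 x.2),
    ← tsum_discounted_telescope M.γ_nonneg M.γ_lt_one hC]
  refine tsum_congr fun t => ?_
  rw [integral_trajLaw_succ μ₀ π K (fun x => M.riskBackup σ V x.1 x.2)]
  simp only [hV, expect]

lemma integral_tsum_gain_le (hV : ∀ s a, M.riskBackup σ V s a ≤ V s) :
    ∫ ω, ∑' t, M.γ ^ t * M.gain σ V K t (ω t) ∂trajLaw μ₀ π K ≤
      ∑ x, μ₀.1 x * M.riskBackup σ V x.1 x.2 := by
  obtain ⟨C, hC⟩ := M.exists_abs_integral_riskBackup_le σ V μ₀ π K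
  have h := M.hasSum_integral_gain σ V μ₀ π K
  rw [← h.tsum_eq, ← integral_trajLaw_zero μ₀ π K (fun x => M.riskBackup σ V x.1 x.2)]
  refine tsum_discounted_le M.γ_nonneg M.γ_lt_one hC h.summable fun t => ?_
  rw [integral_expect]
  exact integral_mono
    (integrable_trajLaw_eval μ₀ π K (fun x => M.riskBackup σ V x.1 x.2) (t + 1))
    (integrable_trajLaw_eval μ₀ π K (fun x => V x.1) (t + 1)) fun ω => hV _ _

/-- If `V` is the risk-sensitive value of `π` from time `1` on, the robust objective is at least
the expected backup of `V` at time `0`. -/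
lemma le_eexpect_total (hD : ∀ s a, ∀ p : Simplex S, D p (M.P s a) =
      ⨆ V : S → ℝ, ((-σ (M.P s a) V - expect p V : ℝ) : EReal))
    (hV : ∀ t h s, ∑ a, (π (t + 1) h s).1 a * M.riskBackup σ V s a = V s) :
    ((∑ x, μ₀.1 x * M.riskBackup σ V x.1 x.2 : ℝ) : EReal) ≤
      eexpect (trajLaw μ₀ π K) (M.total D K) := by
  rw [← integral_tsum_gain_eq μ₀ K hV, ← eexpect_coe (M.integrable_tsum_gain σ V μ₀ π K)]
  exact eexpect_mono (coe_tsum_gain_le_total K hD)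

lemma IsArgminKernel.eexpect_total_eq (hσ : ∀ s a, IsConvexRiskMeasure (σ (M.P s a)))
    (hD : ∀ s a, ∀ p : Simplex S, D p (M.P s a) =
      ⨆ V : S → ℝ, ((-σ (M.P s a) V - expect p V : ℝ) : EReal))
    {K : S → A → Simplex S} (hK : M.IsArgminKernel D V K)
    (hV : ∀ t h s, ∑ a, (π (t + 1) h s).1 a * M.riskBackup σ V s a = V s) :
    eexpect (trajLaw μ₀ π (statTransition K)) (M.total D (statTransition K)) =
      ((∑ x, μ₀.1 x * M.riskBackup σ V x.1 x.2 : ℝ) : EReal) := by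
  rw [← integral_tsum_gain_eq μ₀ (statTransition K) hV,
    ← eexpect_coe (M.integrable_tsum_gain σ V μ₀ π _), funext (hK.total_eq hσ hD)]

/-- This is the upper half of the saddle point: a single stationary kernel works against all
history-dependent policies. -/
lemma IsArgminKernel.eexpect_total_le (hσ : ∀ s a, IsConvexRiskMeasure (σ (M.P s a)))
    (hD : ∀ s a, ∀ p : Simplex S, D p (M.P s a) =
      ⨆ V : S → ℝ, ((-σ (M.P s a) V - expect p V : ℝ) : EReal))
    {K : S → A → Simplex S} (hK : M.IsArgminKernel D V K)
    (hV : ∀ s a, M.riskBackup σ V s a ≤ V s) :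
    eexpect (trajLaw μ₀ π (statTransition K)) (M.total D (statTransition K)) ≤
      ((∑ x, μ₀.1 x * M.riskBackup σ V x.1 x.2 : ℝ) : EReal) := by
  rw [funext (hK.total_eq hσ hD), eexpect_coe (M.integrable_tsum_gain σ V μ₀ π _),
    EReal.coe_le_coe_iff]
  exact integral_tsum_gain_le μ₀ (statTransition K) hV

/-! ### Bounds on the robust objectives. -/

section Objectives

lemma IsRiskValue.le_objV (hD : ∀ s a, ∀ p : Simplex S, D p (M.P s a) =
      ⨆ V : S → ℝ, ((-σ (M.P s a) V - expect p V : ℝ) : EReal))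
    {π : StatPolicy S A} (hV : M.IsRiskValue σ π V) (s : S) :
    (V s : EReal) ≤ M.objV D π.toPolicy K s := by
  have h := le_eexpect_total (π := π.toPolicy) (joint (point s) (π.toPolicy 0 Fin.elim0)) K hD
    fun _ _ s => (hV s).symm
  rwa [sum_joint_point_mul s _ (M.riskBackup σ V), StatPolicy.toPolicy, ← hV s] at h

lemma IsRiskValue.le_objQ (hD : ∀ s a, ∀ p : Simplex S, D p (M.P s a) =
      ⨆ V : S → ℝ, ((-σ (M.P s a) V - expect p V : ℝ) : EReal))
    {π : StatPolicy S A} (hV : M.IsRiskValue σ π V) (s : S) (a : A) :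
    (M.riskBackup σ V s a : EReal) ≤ M.objQ D π.toPolicy K s a := by
  have h := le_eexpect_total (π := π.toPolicy) (point (s, a)) K hD fun _ _ s => (hV s).symm
  rwa [sum_point_mul] at h

variable {K : S → A → Simplex S}

lemma IsArgminKernel.objV_eq (hσ : ∀ s a, IsConvexRiskMeasure (σ (M.P s a)))
    (hD : ∀ s a, ∀ p : Simplex S, D p (M.P s a) =
      ⨆ V : S → ℝ, ((-σ (M.P s a) V - expect p V : ℝ) : EReal))
    (hK : M.IsArgminKernel D V K) {π : StatPolicy S A} (hV : M.IsRiskValue σ π V) (s : S) :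
    M.objV D π.toPolicy (statTransition K) s = V s := by
  have h := hK.eexpect_total_eq (π := π.toPolicy) (joint (point s) (π.toPolicy 0 Fin.elim0)) hσ hD
    fun _ _ s => (hV s).symm
  rwa [sum_joint_point_mul s _ (M.riskBackup σ V), StatPolicy.toPolicy, ← hV s] at h

lemma IsArgminKernel.objQ_eq (hσ : ∀ s a, IsConvexRiskMeasure (σ (M.P s a)))
    (hD : ∀ s a, ∀ p : Simplex S, D p (M.P s a) =
      ⨆ V : S → ℝ, ((-σ (M.P s a) V - expect p V : ℝ) : EReal))
    (hK : M.IsArgminKernel D V K) {π : StatPolicy S A} (hV : M.IsRiskValue σ π V) (s : S) (a : A) :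
    M.objQ D π.toPolicy (statTransition K) s a = M.riskBackup σ V s a := by
  have h := hK.eexpect_total_eq (π := π.toPolicy) (point (s, a)) hσ hD fun _ _ s => (hV s).symm
  rwa [sum_point_mul] at h

lemma IsArgminKernel.objV_le (hσ : ∀ s a, IsConvexRiskMeasure (σ (M.P s a)))
    (hD : ∀ s a, ∀ p : Simplex S, D p (M.P s a) =
      ⨆ V : S → ℝ, ((-σ (M.P s a) V - expect p V : ℝ) : EReal))
    (hK : M.IsArgminKernel D V K) (hV : ∀ s a, M.riskBackup σ V s a ≤ V s) (π : Policy S A)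
    (s : S) : M.objV D π (statTransition K) s ≤ V s := by
  refine (hK.eexpect_total_le _ hσ hD hV).trans (EReal.coe_le_coe_iff.2 ?_)
  rw [sum_joint_point_mul s _ (M.riskBackup σ V)]
  have hs : ∑ a, (π 0 Fin.elim0 s).1 a * V s = V s := by
    rw [← Finset.sum_mul, (π 0 Fin.elim0 s).2.2, one_mul]
  rw [← hs]
  exact Finset.sum_le_sum fun a _ =>
    mul_le_mul_of_nonneg_left (hV s a) ((π 0 Fin.elim0 s).2.1 a)

lemma IsArgminKernel.objQ_le (hσ : ∀ s a, IsConvexRiskMeasure (σ (M.P s a)))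
    (hD : ∀ s a, ∀ p : Simplex S, D p (M.P s a) =
      ⨆ V : S → ℝ, ((-σ (M.P s a) V - expect p V : ℝ) : EReal))
    (hK : M.IsArgminKernel D V K) (hV : ∀ s a, M.riskBackup σ V s a ≤ V s) (π : Policy S A)
    (s : S) (a : A) :
    M.objQ D π (statTransition K) s a ≤ M.riskBackup σ V s a := by
  have h := hK.eexpect_total_le (π := π) (point (s, a)) hσ hD hV
  rwa [sum_point_mul] at h

lemma IsArgminKernel.iInf_objV_eq (hσ : ∀ s a, IsConvexRiskMeasure (σ (M.P s a)))
    (hD : ∀ s a, ∀ p : Simplex S, D p (M.P s a) =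
      ⨆ V : S → ℝ, ((-σ (M.P s a) V - expect p V : ℝ) : EReal))
    (hK : M.IsArgminKernel D V K) {π : StatPolicy S A} (hV : M.IsRiskValue σ π V) (s : S) :
    ⨅ K' : Transition S A, M.objV D π.toPolicy K' s = V s :=
  le_antisymm (iInf_le_of_le (statTransition K) (hK.objV_eq hσ hD hV s).le)
    (le_iInf fun K' => hV.le_objV K' hD s)

end Objectives

end MDP

end RMDP

theorem theorem1 {S A : Type*} [Fintype S] [Fintype A] [Nonempty A]
    [MeasurableSpace S] [MeasurableSingletonClass S]
    [MeasurableSpace A] [MeasurableSingletonClass A]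
    (M : MDP S A)
    (σ : Simplex S → (S → ℝ) → ℝ) (hσ : ∀ s a, IsConvexRiskMeasure (σ (M.P s a)))
    (D : Simplex S → Simplex S → EReal)
    (hD : ∀ s a, ∀ p : Simplex S, D p (M.P s a) =
      ⨆ V : S → ℝ, ((-σ (M.P s a) V - expect p V : ℝ) : EReal))
    (π : StatPolicy S A) :
    -- the risk-sensitive value functions are well defined
    (∃! V : S → ℝ, M.IsRiskOptValue σ V) ∧ (∃! V : S → ℝ, M.IsRiskValue σ π V) ∧
    (∀ s, IsGreatest (Set.range fun π' : StatPolicy S A => M.riskV σ π' s) (M.riskVstar σ s)) ∧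
    -- equality of value functions and Q-functions
    (∀ s, M.robustVstar D s = (M.riskVstar σ s : EReal)) ∧
    (∀ s, M.robustV D π s = (M.riskV σ π s : EReal)) ∧
    (∀ s a, M.robustQstar D s a = (M.riskQstar σ s a : EReal)) ∧
    (∀ s a, M.robustQ D π s a = (M.riskQ σ π s a : EReal)) ∧
    -- the argmax and the argmins exist and solve the sup-inf problem from every initial state
    (∃ f : S → A, M.IsGreedy σ (M.riskVstar σ) f) ∧
    (∃ K : S → A → Simplex S, M.IsArgminKernel D (M.riskVstar σ) K) ∧
    (∀ f : S → A, M.IsGreedy σ (M.riskVstar σ) f →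
      ∀ K : S → A → Simplex S, M.IsArgminKernel D (M.riskVstar σ) K →
        ∀ s₀, M.IsSupInfSolution D (detPolicy f).toPolicy (statTransition K) s₀) ∧
    -- the argmins for `V^π` exist and attain the infimum from every initial state
    (∃ K : S → A → Simplex S, M.IsArgminKernel D (M.riskV σ π) K) ∧
    (∀ K : S → A → Simplex S, M.IsArgminKernel D (M.riskV σ π) K →
      ∀ s₀, M.IsWorstCase D π.toPolicy (statTransition K) s₀) := by
  obtain ⟨f₀, hf₀⟩ := MDP.exists_isGreedy (M := M) (σ := σ) (M.riskVstar σ)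
  obtain ⟨K₀, hK₀⟩ := MDP.exists_isArgminKernel hσ hD (M.riskVstar σ)
  have hopt := MDP.isRiskOptValue_riskVstar hσ
  have hgreedy : ∀ {f}, M.IsGreedy σ (M.riskVstar σ) f →
      M.IsRiskValue σ (detPolicy f) (M.riskVstar σ) := fun hf => hf.isRiskValue hopt
  -- The kernel `K₀` caps every policy at V*, and the greedy policy secures V* against every kernel.
  have hstar : ∀ s, M.robustVstar D s = (M.riskVstar σ s : EReal) := fun s =>
    le_antisymm
      (iSup_le fun π' => iInf_le_of_le (statTransition K₀)
        (hK₀.objV_le hσ hD hopt.riskBackup_le π' s))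
      (le_iSup_of_le (detPolicy f₀).toPolicy (le_iInf fun K => (hgreedy hf₀).le_objV K hD s))
  have hrobust : ∀ (π' : StatPolicy S A) s, M.robustV D π' s = (M.riskV σ π' s : EReal) :=
    fun π' s => by
      obtain ⟨K, hK⟩ := MDP.exists_isArgminKernel hσ hD (M.riskV σ π')
      exact hK.iInf_objV_eq hσ hD (MDP.isRiskValue_riskV hσ π') s
  have hV := MDP.isRiskValue_riskV hσ π
  obtain ⟨Kπ, hKπ⟩ := MDP.exists_isArgminKernel hσ hD (M.riskV σ π)
  refine ⟨MDP.existsUnique_isRiskOptValue hσ, MDP.existsUnique_isRiskValue hσ π, fun s => ⟨?_, ?_⟩,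
    hstar, hrobust π, fun s a => ?_, fun s a => ?_, ⟨f₀, hf₀⟩, ⟨K₀, hK₀⟩,
    fun f hf K hK s => ⟨?_, ?_⟩, ⟨Kπ, hKπ⟩, fun K hK s => ?_⟩
  -- V* solves the fixed-point equation of the greedy policy, so uniqueness identifies it with that
  -- policy's risk value.
  · exact ⟨detPolicy f₀, congrFun ((MDP.existsUnique_isRiskValue hσ (detPolicy f₀)).unique
      (MDP.isRiskValue_riskV hσ _) (hgreedy hf₀)) s⟩
  · rintro _ ⟨π', rfl⟩
    -- Optimality among stationary policies is read off the robust side, where V* is a supremum over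
    -- all policies.
    rw [← EReal.coe_le_coe_iff, ← hrobust π' s, ← hstar s]
    exact le_iSup (fun π'' : Policy S A => ⨅ K, M.objV D π'' K s) π'.toPolicy
  · exact le_antisymm
      (iSup_le fun π' => iInf_le_of_le (statTransition K₀)
        (hK₀.objQ_le hσ hD hopt.riskBackup_le π' s a))
      (le_iSup_of_le (detPolicy f₀).toPolicy (le_iInf fun K => (hgreedy hf₀).le_objQ K hD s a))
  · exact le_antisymm (iInf_le_of_le (statTransition Kπ) (hKπ.objQ_eq hσ hD hV s a).le)
      (le_iInf fun K => hV.le_objQ K hD s a)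
  · rw [hstar, hK.iInf_objV_eq hσ hD (hgreedy hf)]
  · rw [MDP.IsWorstCase, hK.iInf_objV_eq hσ hD (hgreedy hf), hK.objV_eq hσ hD (hgreedy hf)]
  · rw [MDP.IsWorstCase, hK.iInf_objV_eq hσ hD hV, hK.objV_eq hσ hD hV]
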